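/- Let $\Phi:\mathbb{R}^{n_1\times n_2}\to\mathbb{R}^m$ be a linear operator and let $f:\mathbb{R}^m\to\mathbb{R}\cup\{\infty\}$ be a proper, lower semicontinuous, convex function that is twice continuously differentiable on $\operatorname{int}(\operatorname{dom} f)$, where $\operatorname{dom} f=\{y: f(y)<\infty\}$, and whose Hessian $\nabla^2 f(y)$ is positive definite for every $y\in\operatorname{int}(\operatorname{dom} f)$. Equip $\mathbb{R}^{n_1\times n_2}$ with the Frobenius inner product $\langle X,Y\rangle=\operatorname{Tr}(X^TY)$ and its norm $\|\cdot\|_F$, let $\Phi^*$ denote the adjoint of $\Phi$, and let $\|X\|_*$ be the nuclear norm (the sum of the singular values of $X$). Consider the problem $$\min_{X\in\mathbb{R}^{n_1\times n_2}}\ \varphi(X):=f(\Phi X)+\|X\|_* .$$ Let $\bar X$ be an optimal solution of this problem with $\Phi\bar X\in\operatorname{int}(\operatorname{dom} f)$, and suppose that the nondegeneracy condition $$\bar Y:=-\Phi^*\nabla f(\Phi\bar X)\in\operatorname{ri}\,\partial\|\bar X\|_*$$ holds, where $\partial\|\bar X\|_*=\{V:\ \|Z\|_*-\|\bar X\|_*\ge\langle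 V,Z-\bar X\rangle\ \text{for all } Z\in\mathbb{R}^{n_1\times n_2}\}$ is the subdifferential of the nuclear norm at $\bar X$ and $\operatorname{ri}$ denotes the relative interior (the interior relative to the affine hull). Then $\bar X$ is a unique solution, i.e. $\varphi(X)>\varphi(\bar X)$ for all $X\ne\bar X$, if and only if it is a strong solution, i.e. there exist $\varepsilon>0$ and $\kappa>0$ such that $$\varphi(X)-\varphi(\bar X)\ \ge\ \frac{\kappa}{2}\|X-\bar X\|_F^2\quad\text{for all } X \text{ with } \|X-\bar X\|_F<\varepsilon .$$ -/

import Mathlib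

open Matrix

noncomputable section

namespace NuclearMin

/-- The Frobenius inner product `⟨X, Y⟩ = Tr (Xᵀ Y)`. -/
def frobInner {n₁ n₂ : ℕ} (X Y : Matrix (Fin n₁) (Fin n₂) ℝ) : ℝ :=
  (Xᵀ * Y).trace

/-- The Frobenius norm `‖X‖_F = √⟨X, X⟩`. -/
def frobNorm {n₁ n₂ : ℕ} (X : Matrix (Fin n₁) (Fin n₂) ℝ) : ℝ :=
  √(frobInner X X)

/-- The nuclear norm: the sum of all singular values. Mathlib lists the singular values of an
operator on `ℝ^{n₂}` as a sequence indexed from `0` which vanishes from index `n₂` on. -/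
def nuclearNorm {n₁ n₂ : ℕ} (X : Matrix (Fin n₁) (Fin n₂) ℝ) : ℝ :=
  ∑ i ∈ Finset.range n₂, (Matrix.toEuclideanLin X).singularValues i

/-- The subdifferential, for the Frobenius inner product, of a real-valued function `g` at `X`. -/
def subdifferential {n₁ n₂ : ℕ} (g : Matrix (Fin n₁) (Fin n₂) ℝ → ℝ)
    (X : Matrix (Fin n₁) (Fin n₂) ℝ) : Set (Matrix (Fin n₁) (Fin n₂) ℝ) :=
  {V | ∀ Z, frobInner V (Z - X) ≤ g Z - g X}

/-- The adjoint `Φ*` of `Φ`, for the Frobenius and the Euclidean inner products: the entry `(i, j)`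
of `Φ* y` is `⟨Φ E_{ij}, y⟩`, with `E_{ij}` the matrix units. -/
def adjointMap {n₁ n₂ m : ℕ}
    (Φ : Matrix (Fin n₁) (Fin n₂) ℝ →ₗ[ℝ] EuclideanSpace ℝ (Fin m))
    (y : EuclideanSpace ℝ (Fin m)) : Matrix (Fin n₁) (Fin n₂) ℝ :=
  Matrix.of fun i j => inner ℝ (Φ (Matrix.single i j 1)) y

/-- The defining property of the adjoint. -/
theorem frobInner_adjointMap {n₁ n₂ m : ℕ}
    (Φ : Matrix (Fin n₁) (Fin n₂) ℝ →ₗ[ℝ] EuclideanSpace ℝ (Fin m))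
    (y : EuclideanSpace ℝ (Fin m)) (X : Matrix (Fin n₁) (Fin n₂) ℝ) :
    frobInner (adjointMap Φ y) X = inner ℝ y (Φ X) := by
  conv_rhs => rw [Matrix.matrix_eq_sum_single X]
  have h : ∀ i j, Φ (Matrix.single i j (X i j)) = X i j • Φ (Matrix.single i j 1) := by
    intro i j
    rw [← map_smul, Matrix.smul_single, smul_eq_mul, mul_one]
  simp only [map_sum, h, inner_sum, real_inner_smul_right]
  simp only [frobInner, adjointMap, Matrix.trace, Matrix.diag_apply, Matrix.mul_apply,
    Matrix.transpose_apply, Matrix.of_apply]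
  rw [Finset.sum_comm]
  refine Finset.sum_congr rfl fun i _ => Finset.sum_congr rfl fun j _ => ?_
  rw [real_inner_comm, mul_comm]

section Loss

variable {E : Type*} [NormedAddCommGroup E] [InnerProductSpace ℝ E] [CompleteSpace E]

/-- The effective domain `{y | f y < ∞}`. -/
def effDom (f : E → EReal) : Set E := {y | f y < ⊤}

/-- The real-valued function that agrees with `f` wherever `f` is finite. -/
def finitePart (f : E → EReal) : E → ℝ := fun y => (f y).toReal

/-- The assumptions on a loss function `f` with values in `ℝ ∪ {∞}`: `f` is proper, lower
semicontinuous and convex (its epigraph is convex), it is twice continuously differentiable in the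
interior of its domain, and its Hessian is positive definite there. -/
structure IsLoss (f : E → EReal) : Prop where
  ne_bot : ∀ y, f y ≠ ⊥
  dom_nonempty : (effDom f).Nonempty
  lsc : LowerSemicontinuous f
  convex : Convex ℝ {p : E × ℝ | f p.1 ≤ (p.2 : EReal)}
  contDiffOn : ContDiffOn ℝ 2 (finitePart f) (interior (effDom f))
  hessian_posDef : ∀ y ∈ interior (effDom f), ∀ v : E, v ≠ 0 →
    0 < inner ℝ (fderiv ℝ (gradient (finitePart f)) y v) v

end Loss

/-- The objective function `X ↦ f (Φ X) + ‖X‖_*`. -/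
def objective {n₁ n₂ m : ℕ} (f : EuclideanSpace ℝ (Fin m) → EReal)
    (Φ : Matrix (Fin n₁) (Fin n₂) ℝ →ₗ[ℝ] EuclideanSpace ℝ (Fin m))
    (X : Matrix (Fin n₁) (Fin n₂) ℝ) : EReal :=
  f (Φ X) + (nuclearNorm X : EReal)

/-- `X` minimizes `φ` globally. -/
def IsOptimalSolution {n₁ n₂ : ℕ} (φ : Matrix (Fin n₁) (Fin n₂) ℝ → EReal)
    (X : Matrix (Fin n₁) (Fin n₂) ℝ) : Prop :=
  ∀ Z, φ X ≤ φ Z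

/-- `X` is the unique global minimizer of `φ`. -/
def IsUniqueSolution {n₁ n₂ : ℕ} (φ : Matrix (Fin n₁) (Fin n₂) ℝ → EReal)
    (X : Matrix (Fin n₁) (Fin n₂) ℝ) : Prop :=
  ∀ Z, Z ≠ X → φ X < φ Z

/-- `X` is a strong solution: `φ Z - φ X ≥ (κ / 2) ‖Z - X‖_F²` for all `Z` in a ball around `X`. -/
def IsStrongSolution {n₁ n₂ : ℕ} (φ : Matrix (Fin n₁) (Fin n₂) ℝ → EReal)
    (X : Matrix (Fin n₁) (Fin n₂) ℝ) : Prop :=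
  ∃ ε : ℝ, 0 < ε ∧ ∃ κ : ℝ, 0 < κ ∧ ∀ Z, frobNorm (Z - X) < ε →
    ((κ / 2 * frobNorm (Z - X) ^ 2 : ℝ) : EReal) ≤ φ Z - φ X

end NuclearMin

end

/-! Strong implies unique by convexity: a second point with no larger value would keep the objective
below its value at `X` plus zero along a whole segment, against quadratic growth.

Conversely, let the gap be the nuclear norm minus `⟨Y, ·⟩`; it is nonnegative and vanishes at `X`.
If growth fails along `X + t_k W_k`, then `exists_quadratic_growth` for `f` bounds `c t_k² ‖Φ W_k‖²`
plus the gap by `o(t_k²)`. A limit direction `W ≠ 0` satisfies `Φ W = 0`, and the gap vanishes to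
second order towards it. The crux, `exists_nuclearNorm_add_smul_le`, is that the gap then vanishes
at some `X + s W` with `s > 0`: there `f ∘ Φ` and `⟨Y, ·⟩` are unchanged, so uniqueness fails.

For the crux, first order information makes all subgradients at `X` agree on `W`. Second order
information comes from rotating `Y`: for skew `S`, `Y + t S Y` and `Y + t Y S` have norm at most `1
+ C t²`, which forces `W Y*` and `Y* W` to be symmetric. On `ker X`, nondegeneracy makes `Y` a
strict contraction while `W = W Y* Y`, so `W` vanishes there. Hence `Y* (X + s W)` is positive
semidefinite for small `s`, `Y` acts as a polar factor of `X + s W`, and the gap is zero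
(`exists_opNuclear_add_smul_le`). -/

noncomputable section

namespace NuclearMin

open LinearMap Module

set_option linter.unusedSectionVars false

/-! ### Duality between the nuclear norm and contractions -/

section Operators

variable {E F : Type*} [NormedAddCommGroup E] [InnerProductSpace ℝ E] [FiniteDimensional ℝ E]
  [NormedAddCommGroup F] [InnerProductSpace ℝ F] [FiniteDimensional ℝ F]

/-- The Hilbert-Schmidt inner product of two operators. -/
def hsInner (A B : E →ₗ[ℝ] F) : ℝ := LinearMap.trace ℝ E (adjoint A ∘ₗ B)

/-- The nuclear norm of an operator. -/
def opNuclear (T : E →ₗ[ℝ] F) : ℝ := ∑ i ∈ Finset.range (finrank ℝ E), T.singularValues i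

/-- The rank-one operator `x ↦ ⟪b, x⟫ a`. -/
def outer (a : F) (b : E) : E →ₗ[ℝ] F := (innerₛₗ ℝ b).smulRight a

@[simp]
theorem outer_apply (a : F) (b x : E) : outer a b x = (inner ℝ b x : ℝ) • a := rfl

theorem hsInner_eq_sum {ι : Type*} [Fintype ι] (b : OrthonormalBasis ι ℝ E) (A B : E →ₗ[ℝ] F) :
    hsInner A B = ∑ i, inner ℝ (A (b i)) (B (b i)) := by
  simp [hsInner, LinearMap.trace_eq_sum_inner _ b, adjoint_inner_right]

theorem hsInner_add_left (A B C : E →ₗ[ℝ] F) : hsInner (A + B) C = hsInner A C + hsInner B C := by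
  simp [hsInner, LinearMap.add_comp]

theorem hsInner_add_right (A B C : E →ₗ[ℝ] F) : hsInner A (B + C) = hsInner A B + hsInner A C := by
  simp [hsInner, LinearMap.comp_add]

theorem hsInner_smul_left (c : ℝ) (A B : E →ₗ[ℝ] F) : hsInner (c • A) B = c * hsInner A B := by
  simp [hsInner, LinearMap.smul_comp]

theorem hsInner_smul_right (c : ℝ) (A B : E →ₗ[ℝ] F) : hsInner A (c • B) = c * hsInner A B := by
  simp [hsInner, LinearMap.comp_smul]

theorem hsInner_sub_left (A B C : E →ₗ[ℝ] F) : hsInner (A - B) C = hsInner A C - hsInner B C := by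
  simp [hsInner, LinearMap.sub_comp]

theorem hsInner_sub_right (A B C : E →ₗ[ℝ] F) : hsInner A (B - C) = hsInner A B - hsInner A C := by
  simp [hsInner, LinearMap.comp_sub]

theorem hsInner_outer_left (a : F) (b : E) (W : E →ₗ[ℝ] F) :
    hsInner (outer a b) W = inner ℝ a (W b) := by
  rw [hsInner_eq_sum (stdOrthonormalBasis ℝ E)]
  conv_rhs => rw [← (stdOrthonormalBasis ℝ E).sum_repr' b]
  simp only [outer_apply, map_sum, map_smul, inner_sum, real_inner_smul_left, real_inner_smul_right]
  exact Finset.sum_congr rfl fun i _ => by rw [real_inner_comm]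

theorem hsInner_outer_right (a : F) (b : E) (W : E →ₗ[ℝ] F) :
    hsInner W (outer a b) = inner ℝ (W b) a := by
  rw [real_inner_comm, ← hsInner_outer_left, hsInner_eq_sum (stdOrthonormalBasis ℝ E),
    hsInner_eq_sum (stdOrthonormalBasis ℝ E)]
  exact Finset.sum_congr rfl fun i _ => by rw [real_inner_comm]

/-- Singular value decomposition: a basis of right singular vectors. -/
theorem exists_singular_basis (T : E →ₗ[ℝ] F) :
    ∃ v : OrthonormalBasis (Fin (finrank ℝ E)) ℝ E,
      (∀ i j, i ≠ j → inner ℝ (T (v i)) (T (v j)) = 0) ∧ opNuclear T = ∑ i, ‖T (v i)‖ := by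
  have hs := T.isSymmetric_adjoint_comp_self
  have key : ∀ i j, inner ℝ (T (hs.eigenvectorBasis rfl i)) (T (hs.eigenvectorBasis rfl j)) =
      hs.eigenvalues rfl j *
        inner ℝ (hs.eigenvectorBasis rfl i) (hs.eigenvectorBasis rfl j) := by
    intro i j
    rw [← adjoint_inner_right]
    have := hs.apply_eigenvectorBasis rfl j
    simp only [LinearMap.comp_apply] at this
    rw [this, inner_smul_right]
    rfl
  refine ⟨hs.eigenvectorBasis rfl, fun i j hij => ?_, ?_⟩
  · rw [key, (hs.eigenvectorBasis rfl).inner_eq_zero hij, mul_zero]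
  · rw [opNuclear, Finset.sum_range]
    refine Finset.sum_congr rfl fun i _ => ?_
    rw [T.singularValues_fin rfl, norm_eq_sqrt_real_inner, key]
    simp

/-- Cauchy-Schwarz term by term in a basis of right singular vectors of `T`, where the `‖T (v i)‖`
sum to the nuclear norm. -/
theorem hsInner_le_mul_opNuclear {V : E →ₗ[ℝ] F} {c : ℝ} (hV : ∀ x, ‖V x‖ ≤ c * ‖x‖)
    (T : E →ₗ[ℝ] F) : hsInner V T ≤ c * opNuclear T := by
  obtain ⟨v, -, hT⟩ := exists_singular_basis T
  rw [hsInner_eq_sum v, hT, Finset.mul_sum]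
  refine Finset.sum_le_sum fun i _ => (real_inner_le_norm _ _).trans ?_
  have := hV (v i)
  rw [v.norm_eq_one, mul_one] at this
  gcongr

theorem hsInner_le_opNuclear {V : E →ₗ[ℝ] F} (hV : ∀ x, ‖V x‖ ≤ ‖x‖)
    (T : E →ₗ[ℝ] F) : hsInner V T ≤ opNuclear T := by
  simpa using hsInner_le_mul_opNuclear (c := 1) (by simpa using hV) T

/-- The partial isometry in the polar decomposition of `T`, computed from a basis of right singular
vectors. -/
def polarFactor {ι : Type*} [Fintype ι] (T : E →ₗ[ℝ] F) (v : OrthonormalBasis ι ℝ E) :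
    E →ₗ[ℝ] F :=
  ∑ i, outer (‖T (v i)‖⁻¹ • T (v i)) (v i)

section Polar

variable {ι : Type*} [Fintype ι] {T : E →ₗ[ℝ] F} {v : OrthonormalBasis ι ℝ E}

theorem polarFactor_apply (x : E) :
    polarFactor T v x = ∑ i, (inner ℝ (v i) x * ‖T (v i)‖⁻¹) • T (v i) := by
  simp [polarFactor, smul_smul]

theorem polarFactor_apply_basis (i : ι) : polarFactor T v (v i) = ‖T (v i)‖⁻¹ • T (v i) := by
  classical
  rw [polarFactor_apply, Finset.sum_eq_single i]
  · simp
  · intro j _ hj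
    simp [v.inner_eq_zero hj]
  · simp

theorem hsInner_polarFactor : hsInner (polarFactor T v) T = ∑ i, ‖T (v i)‖ := by
  rw [hsInner_eq_sum v]
  refine Finset.sum_congr rfl fun i _ => ?_
  rw [polarFactor_apply_basis, real_inner_smul_left, real_inner_self_eq_norm_sq]
  by_cases h : ‖T (v i)‖ = 0
  · simp [h]
  · field_simp

theorem norm_sum_smul_sq {w : ι → F} (hw : ∀ i j, i ≠ j → inner ℝ (w i) (w j) = 0) (c : ι → ℝ) :
    ‖∑ i, c i • w i‖ ^ 2 = ∑ i, c i ^ 2 * ‖w i‖ ^ 2 := by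
  rw [← real_inner_self_eq_norm_sq, sum_inner]
  refine Finset.sum_congr rfl fun i _ => ?_
  rw [inner_sum, Finset.sum_eq_single i]
  · rw [real_inner_smul_left, real_inner_smul_right, real_inner_self_eq_norm_sq]; ring
  · intro j _ hj
    rw [real_inner_smul_left, real_inner_smul_right, hw i j hj.symm]; simp
  · simp

/-- Pythagoras for the orthogonal vectors `T (v i)`; normalisation makes each coefficient harmless,
and a zero singular value contributes nothing because `0⁻¹ = 0`. -/
theorem norm_polarFactor_apply_le (hv : ∀ i j, i ≠ j → inner ℝ (T (v i)) (T (v j)) = 0) (x : E) :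
    ‖polarFactor T v x‖ ≤ ‖x‖ := by
  refine le_of_sq_le_sq ?_ (norm_nonneg _)
  rw [polarFactor_apply, norm_sum_smul_sq hv, ← v.sum_sq_norm_inner_right x]
  refine Finset.sum_le_sum fun i _ => ?_
  rw [Real.norm_eq_abs, sq_abs, mul_pow, mul_assoc, ← mul_pow]
  by_cases h : ‖T (v i)‖ = 0
  · simp [h, sq_nonneg]
  · rw [inv_mul_cancel₀ h]; simp

theorem inner_smul_apply_eq_zero_of_mem_ker
    (hv : ∀ i j, i ≠ j → inner ℝ (T (v i)) (T (v j)) = 0) {b : E} (hb : T b = 0) (i : ι) :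
    (inner ℝ (v i) b : ℝ) • T (v i) = 0 := by
  have h : (inner ℝ (T (v i)) (T b) : ℝ) = inner ℝ (v i) b * ‖T (v i)‖ ^ 2 := by
    conv_lhs => rw [← v.sum_repr' b]
    rw [map_sum, inner_sum, Finset.sum_eq_single i]
    · rw [map_smul, real_inner_smul_right, real_inner_self_eq_norm_sq]
    · intro j _ hj
      rw [map_smul, real_inner_smul_right, hv i j hj.symm, mul_zero]
    · simp
  rw [hb, inner_zero_right] at h
  rcases mul_eq_zero.1 h.symm with h | h
  · simp [h]
  · simp [norm_eq_zero.1 (pow_eq_zero_iff two_ne_zero |>.1 h)]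

theorem polarFactor_apply_eq_zero (hv : ∀ i j, i ≠ j → inner ℝ (T (v i)) (T (v j)) = 0) {b : E}
    (hb : T b = 0) : polarFactor T v b = 0 := by
  rw [polarFactor_apply]
  refine Finset.sum_eq_zero fun i _ => ?_
  rw [mul_comm, mul_smul, inner_smul_apply_eq_zero_of_mem_ker hv hb, smul_zero]

/-- The two summands act between orthogonal pieces: `a` is orthogonal to the range of `T`, and the
polar factor kills `b`. This supplies subgradients differing by an arbitrary small rank-one block
between the kernels. -/
theorem norm_polarFactor_add_outer_le (hv : ∀ i j, i ≠ j → inner ℝ (T (v i)) (T (v j)) = 0)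
    {a : F} {b : E} (ha : adjoint T a = 0) (hb : T b = 0) (ha1 : ‖a‖ ≤ 1) (hb1 : ‖b‖ ≤ 1) (x : E) :
    ‖(polarFactor T v + outer a b) x‖ ≤ ‖x‖ := by
  refine le_of_sq_le_sq ?_ (norm_nonneg _)
  have horth : inner ℝ (polarFactor T v x) a = 0 := by
    rw [polarFactor_apply, sum_inner]
    refine Finset.sum_eq_zero fun i _ => ?_
    rw [real_inner_smul_left, ← adjoint_inner_right, ha, inner_zero_right, mul_zero]
  set t : ℝ := inner ℝ b x with ht
  -- Dropping the `b`-component costs the polar factor nothing but lowers the bound to `‖x‖² - t²`,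
  -- leaving room for `t² ‖a‖²`.
  have h1 : ‖polarFactor T v x‖ ^ 2 ≤ ‖x - t • b‖ ^ 2 := by
    have : polarFactor T v x = polarFactor T v (x - t • b) := by
      rw [map_sub, map_smul, polarFactor_apply_eq_zero hv hb, smul_zero, sub_zero]
    rw [this]
    gcongr
    exact norm_polarFactor_apply_le hv _
  have h2 : ‖x - t • b‖ ^ 2 = ‖x‖ ^ 2 - 2 * t ^ 2 + t ^ 2 * ‖b‖ ^ 2 := by
    rw [norm_sub_sq_real, real_inner_smul_right, real_inner_comm, ← ht, norm_smul, mul_pow,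
      Real.norm_eq_abs, sq_abs]
    ring
  have h3 : ‖(polarFactor T v + outer a b) x‖ ^ 2 = ‖polarFactor T v x‖ ^ 2 + t ^ 2 * ‖a‖ ^ 2 := by
    rw [LinearMap.add_apply, outer_apply, norm_add_sq_real, real_inner_smul_right, horth, norm_smul,
      mul_pow, Real.norm_eq_abs, sq_abs]
    ring
  have ha2 : ‖a‖ ^ 2 ≤ 1 := pow_le_one₀ (norm_nonneg _) ha1
  have hb2 : ‖b‖ ^ 2 ≤ 1 := pow_le_one₀ (norm_nonneg _) hb1
  nlinarith [mul_le_mul_of_nonneg_left ha2 (sq_nonneg t),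
    mul_le_mul_of_nonneg_left hb2 (sq_nonneg t)]

end Polar

/-- The dual bound is attained by the polar factor, so the nuclear norm is a maximum of linear
functionals and hence sublinear. -/
theorem exists_contraction_hsInner_eq (T : E →ₗ[ℝ] F) :
    ∃ V : E →ₗ[ℝ] F, (∀ x, ‖V x‖ ≤ ‖x‖) ∧ hsInner V T = opNuclear T := by
  obtain ⟨v, hv, hT⟩ := exists_singular_basis T
  exact ⟨polarFactor T v, norm_polarFactor_apply_le hv, by rw [hsInner_polarFactor, hT]⟩

theorem opNuclear_add_le (A B : E →ₗ[ℝ] F) : opNuclear (A + B) ≤ opNuclear A + opNuclear B := by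
  obtain ⟨V, hV, h⟩ := exists_contraction_hsInner_eq (A + B)
  rw [← h, hsInner_add_right]
  exact add_le_add (hsInner_le_opNuclear hV _) (hsInner_le_opNuclear hV _)

theorem opNuclear_smul_le {c : ℝ} (hc : 0 ≤ c) (A : E →ₗ[ℝ] F) :
    opNuclear (c • A) ≤ c * opNuclear A := by
  obtain ⟨V, hV, h⟩ := exists_contraction_hsInner_eq (c • A)
  rw [← h, hsInner_smul_right]
  exact mul_le_mul_of_nonneg_left (hsInner_le_opNuclear hV _) hc

theorem opNuclear_outer_le (a : F) (b : E) : opNuclear (outer a b) ≤ ‖a‖ * ‖b‖ := by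
  obtain ⟨V, hV, h⟩ := exists_contraction_hsInner_eq (outer a b)
  rw [← h, hsInner_outer_right, mul_comm]
  exact (real_inner_le_norm _ _).trans (by gcongr; exact hV b)

/-- Subgradients of the nuclear norm at `T` are the contractions which attain the dual pairing. -/
theorem contraction_of_forall_hsInner_le {V T : E →ₗ[ℝ] F}
    (h : ∀ Z, hsInner V (Z - T) ≤ opNuclear Z - opNuclear T) :
    (∀ x, ‖V x‖ ≤ ‖x‖) ∧ hsInner V T = opNuclear T := by
  -- Testing at `0` and `2 T` squeezes the pairing to equality; testing at the rank-one operator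
  -- `outer (V x) x` then bounds `‖V x‖²` by `‖V x‖ ‖x‖`.
  have h0 := h 0
  have h2 := h ((2 : ℝ) • T)
  have hz : opNuclear (0 : E →ₗ[ℝ] F) = 0 := by simp [opNuclear]
  have h2' := opNuclear_smul_le zero_le_two T
  rw [hsInner_sub_right, hz] at h0
  rw [hsInner_sub_right, hsInner_smul_right] at h2
  have h00 : hsInner V (0 : E →ₗ[ℝ] F) = 0 := by simp [hsInner]
  have hT : hsInner V T = opNuclear T := by linarith
  refine ⟨fun x => ?_, hT⟩
  have h3 := h (outer (V x) x)
  rw [hsInner_sub_right, hT, hsInner_outer_right, real_inner_self_eq_norm_sq] at h3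
  have h4 := opNuclear_outer_le (V x) x
  rcases (norm_nonneg (V x)).eq_or_lt with h5 | h5
  · rw [← h5]; exact norm_nonneg x
  · nlinarith

theorem forall_hsInner_le_of_contraction {V T : E →ₗ[ℝ] F} (hV : ∀ x, ‖V x‖ ≤ ‖x‖)
    (hT : hsInner V T = opNuclear T) (Z : E →ₗ[ℝ] F) :
    hsInner V (Z - T) ≤ opNuclear Z - opNuclear T := by
  rw [hsInner_sub_right, hT]
  linarith [hsInner_le_opNuclear hV Z]

end Operators

end NuclearMin

end

noncomputable section

namespace NuclearMin

open LinearMap Module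

set_option linter.unusedSectionVars false

section Operators

variable {E F : Type*} [NormedAddCommGroup E] [InnerProductSpace ℝ E] [FiniteDimensional ℝ E]
  [NormedAddCommGroup F] [InnerProductSpace ℝ F] [FiniteDimensional ℝ F]

theorem norm_adjoint_apply_le {Y : E →ₗ[ℝ] F} (hY : ∀ x, ‖Y x‖ ≤ ‖x‖) (y : F) :
    ‖adjoint Y y‖ ≤ ‖y‖ := by
  have h : ‖adjoint Y y‖ ^ 2 ≤ ‖adjoint Y y‖ * ‖y‖ := by
    rw [← real_inner_self_eq_norm_sq, adjoint_inner_right]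
    exact (real_inner_le_norm _ _).trans (by gcongr; exact hY _)
  rcases (norm_nonneg (adjoint Y y)).eq_or_lt with h5 | h5
  · rw [← h5]; exact norm_nonneg y
  · nlinarith

/-! ### Contractions that attain the dual pairing with `T` -/

section Aligned

variable {ι : Type*} [Fintype ι] {T Y : E →ₗ[ℝ] F} {v : OrthonormalBasis ι ℝ E}

/-- Equality of the sums forces equality in each termwise bound. -/
theorem inner_apply_eq_norm_of_aligned (hY : ∀ x, ‖Y x‖ ≤ ‖x‖)
    (hYT : hsInner Y T = ∑ i, ‖T (v i)‖) (i : ι) :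
    inner ℝ (Y (v i)) (T (v i)) = ‖T (v i)‖ := by
  rw [hsInner_eq_sum v] at hYT
  refine (Finset.sum_eq_sum_iff_of_le fun i _ => ?_).1 hYT i (Finset.mem_univ i)
  refine (real_inner_le_norm _ _).trans ?_
  have := hY (v i)
  rw [v.norm_eq_one] at this
  exact mul_le_of_le_one_left (norm_nonneg _) this

/-- The equality case of Cauchy-Schwarz: expanding the squared distance between the two sides leaves
at most `σ² - 2σ² + σ² = 0`, with `σ = ‖T (v i)‖`. -/
theorem adjoint_apply_of_aligned (hY : ∀ x, ‖Y x‖ ≤ ‖x‖)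
    (hYT : hsInner Y T = ∑ i, ‖T (v i)‖) (i : ι) :
    adjoint Y (T (v i)) = ‖T (v i)‖ • v i := by
  have h1 : inner ℝ (adjoint Y (T (v i))) (v i) = ‖T (v i)‖ := by
    rw [adjoint_inner_left, real_inner_comm, inner_apply_eq_norm_of_aligned hY hYT i]
  have h2 : ‖adjoint Y (T (v i)) - ‖T (v i)‖ • v i‖ ^ 2 ≤ 0 := by
    rw [norm_sub_sq_real, real_inner_smul_right, h1, norm_smul, v.norm_eq_one, norm_norm, mul_one]
    have := pow_le_pow_left₀ (norm_nonneg _) (norm_adjoint_apply_le hY (T (v i))) 2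
    nlinarith
  exact sub_eq_zero.1 (norm_eq_zero.1 (pow_eq_zero_iff two_ne_zero |>.1
    (le_antisymm h2 (sq_nonneg _))))

theorem apply_of_aligned (hY : ∀ x, ‖Y x‖ ≤ ‖x‖)
    (hYT : hsInner Y T = ∑ i, ‖T (v i)‖) (i : ι) :
    ‖T (v i)‖ • Y (v i) = T (v i) := by
  have h1 := inner_apply_eq_norm_of_aligned hY hYT i
  have h2 : ‖‖T (v i)‖ • Y (v i) - T (v i)‖ ^ 2 ≤ 0 := by
    rw [norm_sub_sq_real, real_inner_smul_left, h1, norm_smul, norm_norm]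
    have := hY (v i)
    rw [v.norm_eq_one] at this
    have := pow_le_one₀ (norm_nonneg _) this (n := 2)
    nlinarith [sq_nonneg ‖T (v i)‖]
  exact sub_eq_zero.1 (norm_eq_zero.1 (pow_eq_zero_iff two_ne_zero |>.1
    (le_antisymm h2 (sq_nonneg _))))

theorem comp_adjoint_comp_of_aligned (hY : ∀ x, ‖Y x‖ ≤ ‖x‖)
    (hYT : hsInner Y T = ∑ i, ‖T (v i)‖) : Y ∘ₗ adjoint Y ∘ₗ T = T := by
  refine v.toBasis.ext fun i => ?_
  simp only [OrthonormalBasis.coe_toBasis, LinearMap.comp_apply]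
  rw [adjoint_apply_of_aligned hY hYT, map_smul, apply_of_aligned hY hYT]

theorem isSymmetric_adjoint_comp_of_aligned (hY : ∀ x, ‖Y x‖ ≤ ‖x‖)
    (hYT : hsInner Y T = ∑ i, ‖T (v i)‖) : adjoint T ∘ₗ Y = adjoint Y ∘ₗ T := by
  classical
  refine v.toBasis.ext fun i => InnerProductSpace.ext_inner_left_basis v.toBasis fun j => ?_
  simp only [OrthonormalBasis.coe_toBasis, LinearMap.comp_apply]
  rw [adjoint_inner_right, ← adjoint_inner_left, adjoint_apply_of_aligned hY hYT,
    adjoint_apply_of_aligned hY hYT, real_inner_smul_left, real_inner_smul_right]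
  by_cases h : j = i
  · rw [h]
  · rw [v.inner_eq_zero h]; simp

/-- `Y* T` is positive definite transversally to the kernel of `T`. -/
theorem exists_pos_add_smul_of_aligned (hY : ∀ x, ‖Y x‖ ≤ ‖x‖)
    (hYT : hsInner Y T = ∑ i, ‖T (v i)‖) {W : E →ₗ[ℝ] E} (hW : adjoint W = W)
    (hTW : ∀ b, T b = 0 → W b = 0) :
    ∃ s : ℝ, 0 < s ∧ ∀ x, 0 ≤ inner ℝ ((adjoint Y ∘ₗ T + s • W) x) x := by
  classical
  -- `μ` is a positive lower bound for the nonzero singular values of `T`.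
  obtain ⟨μ, hμ, hμT⟩ : ∃ μ : ℝ, 0 < μ ∧ ∀ i, T (v i) ≠ 0 → μ ≤ ‖T (v i)‖ := by
    have : ∀ i, ∀ᶠ μ : ℝ in nhdsWithin 0 (Set.Ioi 0), T (v i) ≠ 0 → μ ≤ ‖T (v i)‖ := by
      intro i
      by_cases h : T (v i) = 0
      · simp [h]
      · filter_upwards [Ioo_mem_nhdsGT (norm_pos_iff.2 h)] with μ hμ _ using hμ.2.le
    obtain ⟨μ, h1, h2⟩ := ((Filter.eventually_all.2 this).and self_mem_nhdsWithin).exists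
    exact ⟨μ, h2, h1⟩
  set C := ‖W.toContinuousLinearMap‖ with hC
  have hC0 : 0 ≤ C := norm_nonneg _
  refine ⟨μ / (C + 1), by positivity, fun x => ?_⟩
  -- `p` is the projection of `x` away from `ker T`. Both forms depend only on `p`: one is at least
  -- `μ ‖p‖²`, the other at least `-C ‖p‖²`.
  set c : ι → ℝ := fun i => if T (v i) = 0 then 0 else inner ℝ (v i) x with hc
  set p : E := ∑ i, c i • v i with hp
  have hpx : W x = W p := by
    conv_lhs => rw [← v.sum_repr' x]
    rw [hp, map_sum, map_sum]
    refine Finset.sum_congr rfl fun i _ => ?_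
    by_cases h : T (v i) = 0
    · simp [hc, h, hTW _ h]
    · simp [hc, h]
  have hWp : inner ℝ (W x) x = inner ℝ (W p) p := by
    have h1 : ∀ a b, (inner ℝ (W a) b : ℝ) = inner ℝ a (W b) := fun a b => by
      conv_lhs => rw [← hW]
      rw [adjoint_inner_left]
    rw [hpx, h1, hpx, ← h1]
  have hpn : ‖p‖ ^ 2 = ∑ i, c i ^ 2 := by
    rw [hp, norm_sum_smul_sq fun i j hij => v.inner_eq_zero hij]
    simp
  have hH : inner ℝ ((adjoint Y ∘ₗ T) x) x = ∑ i, ‖T (v i)‖ * c i ^ 2 := by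
    conv_lhs =>
      arg 2
      rw [← v.sum_repr' x]
    simp only [map_sum, map_smul, sum_inner, LinearMap.comp_apply]
    refine Finset.sum_congr rfl fun i _ => ?_
    rw [adjoint_apply_of_aligned hY hYT, real_inner_smul_left, real_inner_smul_left]
    by_cases h : T (v i) = 0
    · simp [h]
    · simp only [hc, h, if_false]; ring
  have hH2 : μ * ‖p‖ ^ 2 ≤ inner ℝ ((adjoint Y ∘ₗ T) x) x := by
    rw [hH, hpn, Finset.mul_sum]
    refine Finset.sum_le_sum fun i _ => ?_
    by_cases h : T (v i) = 0
    · simp [hc, h]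
    · exact mul_le_mul_of_nonneg_right (hμT i h) (sq_nonneg _)
  have hWb : -(C * ‖p‖ ^ 2) ≤ inner ℝ (W p) p := by
    have h1 := abs_real_inner_le_norm (W p) p
    have h2 : ‖W p‖ ≤ C * ‖p‖ := W.toContinuousLinearMap.le_opNorm p
    have h3 := neg_le_of_abs_le h1
    nlinarith [norm_nonneg p]
  rw [LinearMap.add_apply, inner_add_left, LinearMap.smul_apply, real_inner_smul_left, hWp]
  have h4 : μ / (C + 1) * (C * ‖p‖ ^ 2) ≤ μ * ‖p‖ ^ 2 := by
    rw [← mul_assoc]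
    gcongr
    rw [div_mul_eq_mul_div, div_le_iff₀ (by positivity)]
    nlinarith
  nlinarith [mul_le_mul_of_nonneg_left hWb (by positivity : 0 ≤ μ / (C + 1))]

end Aligned

/-! ### Directions along which the gap vanishes -/

/-- In an eigenbasis of `Q` each term is a nonnegative eigenvalue times an inner product of two
vectors of norm at most one. -/
theorem hsInner_le_trace_of_nonneg {V Y : E →ₗ[ℝ] F} {Q : E →ₗ[ℝ] E} (hV : ∀ x, ‖V x‖ ≤ ‖x‖)
    (hY : ∀ x, ‖Y x‖ ≤ ‖x‖) (hQ : Q.IsSymmetric) (hQ0 : ∀ x, 0 ≤ inner ℝ (Q x) x) :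
    hsInner V (Y ∘ₗ Q) ≤ LinearMap.trace ℝ E Q := by
  have hE := hQ.apply_eigenvectorBasis rfl
  have h1 := hQ.eigenvectorBasis rfl |>.norm_eq_one
  rw [hsInner_eq_sum (hQ.eigenvectorBasis rfl),
    LinearMap.trace_eq_sum_inner _ (hQ.eigenvectorBasis rfl)]
  refine Finset.sum_le_sum fun i _ => ?_
  have h0 := hQ0 (hQ.eigenvectorBasis rfl i)
  rw [real_inner_comm, hE] at h0
  rw [LinearMap.comp_apply, hE, map_smul]
  simp only [real_inner_smul_right, real_inner_self_eq_norm_sq, h1] at h0 ⊢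
  gcongr
  · simpa using h0
  · have := real_inner_le_norm (V (hQ.eigenvectorBasis rfl i)) (Y (hQ.eigenvectorBasis rfl i))
    have hv := hV (hQ.eigenvectorBasis rfl i)
    have hy := hY (hQ.eigenvectorBasis rfl i)
    rw [h1] at hv hy
    have := mul_le_one₀ hv (norm_nonneg _) hy
    linarith

/-- The hypotheses say that `Z = Y Q` with `Q = Y* Z` positive semidefinite, so no contraction pairs
with `Z` beyond `tr Q`, which is the pairing with `Y`. -/
theorem opNuclear_le_hsInner {Y Z : E →ₗ[ℝ] F} (hY : ∀ x, ‖Y x‖ ≤ ‖x‖)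
    (hYZ : Y ∘ₗ adjoint Y ∘ₗ Z = Z) (hsymm : adjoint Z ∘ₗ Y = adjoint Y ∘ₗ Z)
    (hpos : ∀ x, 0 ≤ inner ℝ ((adjoint Y ∘ₗ Z) x) x) : opNuclear Z ≤ hsInner Y Z := by
  obtain ⟨V, hV, h⟩ := exists_contraction_hsInner_eq Z
  have hQ : (adjoint Y ∘ₗ Z).IsSymmetric := by
    intro a b
    conv_lhs => rw [← hsymm]
    simp only [LinearMap.comp_apply, adjoint_inner_left, adjoint_inner_right]
  rw [← h, ← hYZ]
  refine (hsInner_le_trace_of_nonneg hV hY hQ hpos).trans ?_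
  rw [hYZ, hsInner]

/-- A direction along which the gap `opNuclear - hsInner Y` vanishes to second order is a direction
along which it vanishes identically near `T`. -/
theorem exists_opNuclear_add_smul_le {T Y W : E →ₗ[ℝ] F} (hY : ∀ x, ‖Y x‖ ≤ ‖x‖)
    (hYT : hsInner Y T = opNuclear T)
    (hri : ∀ V : E →ₗ[ℝ] F, (∀ x, ‖V x‖ ≤ ‖x‖) → hsInner V T = opNuclear T →
      ∃ ε : ℝ, 0 < ε ∧ ∀ x, ‖(Y + ε • (Y - V)) x‖ ≤ ‖x‖)
    (hV : ∀ V : E →ₗ[ℝ] F, (∀ x, ‖V x‖ ≤ ‖x‖) → hsInner V T = opNuclear T →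
      hsInner V W = hsInner Y W)
    (hl : ∀ a b, inner ℝ a (W (adjoint Y b)) = inner ℝ b (W (adjoint Y a)))
    (hr : ∀ a b, inner ℝ (Y a) (W b) = inner ℝ (Y b) (W a)) :
    ∃ s : ℝ, 0 < s ∧ opNuclear (T + s • W) ≤ hsInner Y (T + s • W) := by
  obtain ⟨v, hv, hT⟩ := exists_singular_basis T
  have hYTv := hYT
  rw [hT] at hYTv
  have hTT := comp_adjoint_comp_of_aligned hY hYTv
  have hTsymm := isSymmetric_adjoint_comp_of_aligned hY hYTv
  have hTT' : ∀ x, Y (adjoint Y (T x)) = T x := fun x => LinearMap.congr_fun hTT x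
  have hTs : ∀ x, adjoint T (Y x) = adjoint Y (T x) := fun x => LinearMap.congr_fun hTsymm x
  have hTadj : ∀ z, adjoint T (Y (adjoint Y z)) = adjoint T z := fun z => by
    refine ext_inner_right ℝ fun x => ?_
    rw [adjoint_inner_left, adjoint_inner_left, ← adjoint_inner_right, adjoint_inner_left Y, hTT']
  have hTadj' : ∀ z, adjoint Y (Y (adjoint T z)) = adjoint T z := fun z => by
    rw [← hTadj z, hTs, hTT']
  have hWsymm : ∀ x, adjoint W (Y x) = adjoint Y (W x) := fun x => by
    refine ext_inner_right ℝ fun y => ?_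
    rw [adjoint_inner_left, adjoint_inner_left, hr, real_inner_comm]
  have hWsymm' : ∀ x, W (adjoint Y x) = Y (adjoint W x) := fun x => by
    refine ext_inner_left ℝ fun y => ?_
    rw [hl, ← adjoint_inner_left, ← adjoint_inner_left, adjoint_adjoint, real_inner_comm]
  have hY1 : ∀ b, T b = 0 → adjoint T (Y b) = 0 := fun b hb => by rw [hTs, hb, map_zero]
  have hY2 : ∀ a, adjoint T a = 0 → T (adjoint Y a) = 0 := fun a ha => by
    rw [← hTT', ← hTs, hTadj, ha, map_zero]
  -- The polar factor with and without the block `outer a b` are both subgradients, so they agree on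
  -- `W`.
  have hD1 : ∀ a b, adjoint T a = 0 → T b = 0 → ‖a‖ ≤ 1 → ‖b‖ ≤ 1 → inner ℝ a (W b) = 0 := by
    intro a b ha hb ha1 hb1
    have h1 := hV (polarFactor T v) (norm_polarFactor_apply_le hv) (by rw [hsInner_polarFactor, hT])
    have h2 := hV (polarFactor T v + outer a b) (norm_polarFactor_add_outer_le hv ha hb ha1 hb1)
      (by rw [hsInner_add_left, hsInner_polarFactor, hT, hsInner_outer_left, hb]; simp)
    rw [hsInner_add_left, hsInner_outer_left] at h2
    linarith
  have hD : ∀ a b, adjoint T a = 0 → T b = 0 → inner ℝ a (W b) = 0 := by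
    intro a b ha hb
    have h := hD1 ((‖a‖ + 1)⁻¹ • a) ((‖b‖ + 1)⁻¹ • b) (by simp [ha]) (by simp [hb])
      (by rw [norm_smul, norm_inv, Real.norm_of_nonneg (by positivity),
            inv_mul_le_iff₀ (by positivity)]; linarith)
      (by rw [norm_smul, norm_inv, Real.norm_of_nonneg (by positivity),
            inv_mul_le_iff₀ (by positivity)]; linarith)
    rw [map_smul, real_inner_smul_left, real_inner_smul_right] at h
    have ha1 : (‖a‖ + 1)⁻¹ ≠ 0 := by positivity
    have hb1 : (‖b‖ + 1)⁻¹ ≠ 0 := by positivity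
    simpa [ha1, hb1] using h
  -- Nondegeneracy allows a step past `Y` away from the polar factor. The latter is zero on `ker T`,
  -- so `(1 + ε) Y` is still contractive there.
  obtain ⟨ρ, hρ0, hρ1, hρ⟩ : ∃ ρ : ℝ, 0 ≤ ρ ∧ ρ < 1 ∧ ∀ b, T b = 0 → ‖Y b‖ ≤ ρ * ‖b‖ := by
    obtain ⟨ε, hε, h⟩ := hri (polarFactor T v) (norm_polarFactor_apply_le hv)
      (by rw [hsInner_polarFactor, hT])
    refine ⟨(1 + ε)⁻¹, by positivity, inv_lt_one_of_one_lt₀ (by linarith), fun b hb => ?_⟩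
    have h1 := h b
    have h2 : (Y + ε • (Y - polarFactor T v)) b = (1 + ε) • Y b := by
      simp [polarFactor_apply_eq_zero hv hb, add_smul]
    rw [h2, norm_smul, Real.norm_of_nonneg (by positivity)] at h1
    rwa [le_inv_mul_iff₀ (by positivity)]
  have hran : ∀ z, (∀ a, adjoint T a = 0 → inner ℝ a z = 0) → Y (adjoint Y z) = z := by
    intro z hz
    have : z ∈ (adjoint T).kerᗮ := (Submodule.mem_orthogonal _ _).2 fun a ha => hz a ha
    rw [LinearMap.orthogonal_ker, adjoint_adjoint] at this
    obtain ⟨x, rfl⟩ := this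
    exact hTT' x
  have hran' : ∀ z, (∀ b, T b = 0 → inner ℝ b z = 0) → adjoint Y (Y z) = z := by
    intro z hz
    have : z ∈ T.kerᗮ := (Submodule.mem_orthogonal _ _).2 fun a ha => hz a ha
    rw [LinearMap.orthogonal_ker] at this
    obtain ⟨x, rfl⟩ := this
    exact hTadj' x
  -- `W b` lies in the range of `T`, where `Y Y*` is the identity; the two symmetries then give `W b
  -- = Y Y* W b = Y W* Y b = W Y* Y b`.
  have hstep : ∀ b, T b = 0 → W b = W (adjoint Y (Y b)) := fun b hb => by
    rw [← hran (W b) fun a ha => hD a b ha hb, ← hWsymm, hWsymm']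
  -- `Y* Y` maps `ker T` to itself and shrinks it by `ρ < 1`, so iterating the identity drives `W b`
  -- to zero.
  have hker : ∀ b, T b = 0 → W b = 0 := by
    have hC : ∀ k : ℕ, ∀ b, T b = 0 → ‖W b‖ ≤ ‖W.toContinuousLinearMap‖ * ‖b‖ * ρ ^ k := by
      intro k
      induction k with
      | zero => intro b _; simpa using W.toContinuousLinearMap.le_opNorm b
      | succ k ih =>
        intro b hb
        rw [hstep b hb]
        refine (ih _ (hY2 _ (hY1 b hb))).trans ?_
        have : ‖adjoint Y (Y b)‖ ≤ ρ * ‖b‖ := (norm_adjoint_apply_le hY _).trans (hρ b hb)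
        calc _ ≤ ‖W.toContinuousLinearMap‖ * (ρ * ‖b‖) * ρ ^ k := by gcongr
          _ = _ := by ring
    intro b hb
    have hlim : Filter.Tendsto (fun k : ℕ => ‖W.toContinuousLinearMap‖ * ‖b‖ * ρ ^ k) Filter.atTop
        (nhds 0) := by
      simpa using (tendsto_pow_atTop_nhds_zero_of_lt_one hρ0 hρ1).const_mul
        (‖W.toContinuousLinearMap‖ * ‖b‖)
    exact norm_le_zero_iff.1 (ge_of_tendsto' hlim fun k => hC k b hb)
  have hker' : ∀ a, adjoint T a = 0 → adjoint W a = 0 := by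
    intro a ha
    rw [← hran' (adjoint W a) fun b hb => by
      rw [adjoint_inner_right, hker b hb, inner_zero_left], ← hWsymm', hker _ (hY2 a ha), map_zero]
  have hWW : ∀ x, Y (adjoint Y (W x)) = W x := fun x => hran _ fun a ha => by
    rw [← adjoint_inner_left, hker' a ha, inner_zero_left]
  have hself : adjoint (adjoint Y ∘ₗ W) = adjoint Y ∘ₗ W := by
    rw [adjoint_comp, adjoint_adjoint]
    exact LinearMap.ext fun x => hWsymm x
  obtain ⟨s, hs, hpos⟩ := exists_pos_add_smul_of_aligned hY hYTv hself
    fun b hb => by rw [LinearMap.comp_apply, hker b hb, map_zero]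
  refine ⟨s, hs, opNuclear_le_hsInner hY ?_ ?_ ?_⟩
  · exact LinearMap.ext fun x => by simp [hTT', hWW]
  · exact LinearMap.ext fun x => by simp [hTs, hWsymm]
  · simpa [LinearMap.comp_add, LinearMap.comp_smul] using hpos

/-! ### Infinitesimal rotations of a contraction -/

/-- The cross term in `‖x + t • S x‖²` vanishes, so there is no first order growth in `t`. -/
theorem exists_norm_one_add_smul_le {S : E →ₗ[ℝ] E} (hS : ∀ x, inner ℝ (S x) x = 0) :
    ∃ C : ℝ, 0 ≤ C ∧ ∀ (t : ℝ) (x : E), ‖x + t • S x‖ ≤ (1 + C * t ^ 2) * ‖x‖ := by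
  refine ⟨‖S.toContinuousLinearMap‖ ^ 2, sq_nonneg _, fun t x => ?_⟩
  set c := ‖S.toContinuousLinearMap‖
  have h1 : ‖S x‖ ≤ c * ‖x‖ := S.toContinuousLinearMap.le_opNorm x
  refine le_of_sq_le_sq ?_ (by positivity)
  rw [norm_add_sq_real, real_inner_smul_right, real_inner_comm, hS, norm_smul, mul_pow,
    Real.norm_eq_abs, sq_abs, mul_pow]
  have h2 : ‖S x‖ ^ 2 ≤ c ^ 2 * ‖x‖ ^ 2 := by
    rw [← mul_pow]; gcongr
  have h3 : 0 ≤ c ^ 2 * t ^ 2 := by positivity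
  nlinarith [mul_le_mul_of_nonneg_left h2 (sq_nonneg t), mul_nonneg h3 (sq_nonneg ‖x‖),
    mul_nonneg (mul_nonneg h3 h3) (sq_nonneg ‖x‖)]

/-- Rotating a contraction `Y` infinitesimally stays within the contractions up to second order. -/
theorem exists_hsInner_skew_left_le {Y : E →ₗ[ℝ] F} (hY : ∀ x, ‖Y x‖ ≤ ‖x‖) {S : F →ₗ[ℝ] F}
    (hS : ∀ x, inner ℝ (S x) x = 0) :
    ∃ C : ℝ, 0 ≤ C ∧ ∀ (t : ℝ) (Z : E →ₗ[ℝ] F),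
      hsInner Y Z + t * hsInner (S ∘ₗ Y) Z ≤ (1 + C * t ^ 2) * opNuclear Z := by
  obtain ⟨C, hC, h⟩ := exists_norm_one_add_smul_le hS
  refine ⟨C, hC, fun t Z => ?_⟩
  rw [← hsInner_smul_left, ← hsInner_add_left]
  refine hsInner_le_mul_opNuclear (fun x => ?_) Z
  refine (h t (Y x)).trans ?_
  gcongr
  exact hY x

theorem exists_hsInner_skew_right_le {Y : E →ₗ[ℝ] F} (hY : ∀ x, ‖Y x‖ ≤ ‖x‖) {S : E →ₗ[ℝ] E}
    (hS : ∀ x, inner ℝ (S x) x = 0) :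
    ∃ C : ℝ, 0 ≤ C ∧ ∀ (t : ℝ) (Z : E →ₗ[ℝ] F),
      hsInner Y Z + t * hsInner (Y ∘ₗ S) Z ≤ (1 + C * t ^ 2) * opNuclear Z := by
  obtain ⟨C, hC, h⟩ := exists_norm_one_add_smul_le hS
  refine ⟨C, hC, fun t Z => ?_⟩
  rw [← hsInner_smul_left, ← hsInner_add_left]
  refine hsInner_le_mul_opNuclear (fun x => ?_) Z
  have : (Y + t • Y ∘ₗ S) x = Y (x + t • S x) := by simp
  rw [this]
  exact (hY _).trans (h t x)

theorem inner_outer_sub_outer (a b x : E) : inner ℝ ((outer a b - outer b a) x) x = 0 := by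
  simp only [LinearMap.sub_apply, outer_apply, inner_sub_left, real_inner_smul_left]
  ring

theorem hsInner_skew_left (Y W : E →ₗ[ℝ] F) (a b : F) :
    hsInner ((outer a b - outer b a) ∘ₗ Y) W =
      inner ℝ a (W (adjoint Y b)) - inner ℝ b (W (adjoint Y a)) := by
  have h : ∀ a b : F, outer a b ∘ₗ Y = outer a (adjoint Y b) := fun a b =>
    LinearMap.ext fun x => by simp [adjoint_inner_left]
  rw [LinearMap.sub_comp, hsInner_sub_left, h, h, hsInner_outer_left, hsInner_outer_left]

theorem hsInner_skew_right (Y W : E →ₗ[ℝ] F) (a b : E) :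
    hsInner (Y ∘ₗ (outer a b - outer b a)) W =
      inner ℝ (Y a) (W b) - inner ℝ (Y b) (W a) := by
  have h : ∀ a b : E, Y ∘ₗ outer a b = outer (Y a) b := fun a b =>
    LinearMap.ext fun x => by simp
  rw [LinearMap.comp_sub, hsInner_sub_left, h, h, hsInner_outer_left, hsInner_outer_left]

theorem eq_zero_of_forall_add_mul_le {p q C : ℝ}
    (h : ∀ t : ℝ, p + t * q ≤ (1 + C * t ^ 2) * p) : q = 0 := by
  by_contra hq
  set D := C * p with hD
  have h1 : ∀ t : ℝ, t * q ≤ D * t ^ 2 := fun t => by nlinarith [h t]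
  have h2 := h1 (q / (|D| + 1))
  have h3 : 0 < q ^ 2 := by positivity
  have h4 : 0 < |D| + 1 := by positivity
  have h5 : q / (|D| + 1) * q = q ^ 2 * (|D| + 1) / (|D| + 1) ^ 2 := by field_simp
  rw [h5, div_pow, ← mul_div_assoc, div_le_div_iff_of_pos_right (by positivity)] at h2
  nlinarith [le_abs_self D]

end Operators

end NuclearMin

end

noncomputable section

namespace NuclearMin

open Filter Topology

/-! ### Quadratic growth from a positive definite Hessian -/

section Growth

variable {E : Type*} [NormedAddCommGroup E] [InnerProductSpace ℝ E] [FiniteDimensional ℝ E]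

theorem exists_pos_mul_norm_sq_le (A : E →L[ℝ] E) (hA : ∀ v, v ≠ 0 → 0 < inner ℝ (A v) v) :
    ∃ μ : ℝ, 0 < μ ∧ ∀ v, μ * ‖v‖ ^ 2 ≤ inner ℝ (A v) v := by
  have hc : ContinuousOn (fun v : E => (inner ℝ (A v) v : ℝ)) (Metric.sphere 0 1) := by fun_prop
  obtain ⟨μ, hμ, h⟩ := (isCompact_sphere (0 : E) 1).exists_forall_le' hc (a := 0)
    fun v hv => hA v (ne_zero_of_mem_unit_sphere ⟨v, hv⟩)
  refine ⟨μ, hμ, fun v => ?_⟩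
  by_cases hv : v = 0
  · simp [hv]
  · have hn : ‖v‖ ≠ 0 := norm_ne_zero_iff.2 hv
    have := h (‖v‖⁻¹ • v) (by simp [norm_smul, hn])
    rw [map_smul, real_inner_smul_left, real_inner_smul_right, ← mul_assoc, ← mul_inv,
      le_inv_mul_iff₀ (by positivity)] at this
    linarith

/-- A function with positive definite Hessian at a point lies above its tangent there by a
quadratic margin. -/
theorem exists_quadratic_growth {F : E → ℝ} {y₀ : E} (hF : ContDiffAt ℝ 2 F y₀)
    (hH : ∀ v : E, v ≠ 0 → 0 < inner ℝ (fderiv ℝ (gradient F) y₀ v) v) :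
    ∃ c : ℝ, 0 < c ∧ ∀ᶠ y in 𝓝 y₀,
      c * ‖y - y₀‖ ^ 2 ≤ F y - F y₀ - inner ℝ (gradient F y₀) (y - y₀) := by
  obtain ⟨μ, hμ, hμH⟩ := exists_pos_mul_norm_sq_le _ hH
  have hG : DifferentiableAt ℝ (gradient F) y₀ := by
    have h1 : ContDiffAt ℝ 1 (fderiv ℝ F) y₀ := hF.fderiv_right (by norm_num)
    exact ((InnerProductSpace.toDual ℝ E).symm.toContinuousLinearEquiv.differentiable
      |>.differentiableAt).comp y₀ (h1.differentiableAt (by norm_num))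
  have hlo := hG.hasFDerivAt.isLittleO.def (half_pos hμ)
  have hdiff : ∀ᶠ y in 𝓝 y₀, DifferentiableAt ℝ F y :=
    (hF.eventually (by simp)).mono fun y hy => hy.differentiableAt (by norm_num)
  obtain ⟨r, hr, hball⟩ := Metric.eventually_nhds_iff_ball.1 (hlo.and hdiff)
  refine ⟨μ / 4, by positivity, Metric.eventually_nhds_iff_ball.2 ⟨r, hr, fun y hy => ?_⟩⟩
  set h := y - y₀ with hh
  have hhr : ‖h‖ < r := by rwa [mem_ball_iff_norm] at hy
  have hmem : ∀ t ∈ Set.Icc (0 : ℝ) 1, y₀ + t • h ∈ Metric.ball y₀ r := by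
    intro t ht
    rw [mem_ball_iff_norm, add_sub_cancel_left, norm_smul, Real.norm_of_nonneg ht.1]
    exact (mul_le_of_le_one_left (norm_nonneg _) ht.2).trans_lt hhr
  -- With gradient error at most `μ/2 · t ‖h‖`, the derivative of `ψ` is at least `(μ - μ/2 - μ/2) t
  -- ‖h‖² = 0`; this is why the growth constant is `μ / 4`.
  set ψ : ℝ → ℝ := fun t => F (y₀ + t • h) - t * inner ℝ (gradient F y₀) h
    - μ / 4 * t ^ 2 * ‖h‖ ^ 2 with hψ
  have hderiv : ∀ t ∈ Set.Icc (0 : ℝ) 1, HasDerivAt ψ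
      (inner ℝ (gradient F (y₀ + t • h)) h - inner ℝ (gradient F y₀) h
        - μ / 2 * t * ‖h‖ ^ 2) t := by
    intro t ht
    have h1 : HasDerivAt (fun t : ℝ => y₀ + t • h) h t := by
      simpa using ((hasDerivAt_id t).smul_const h).const_add y₀
    have h2 := (hball _ (hmem t ht)).2.hasFDerivAt.comp_hasDerivAt t h1
    have h3 : fderiv ℝ F (y₀ + t • h) h = inner ℝ (gradient F (y₀ + t • h)) h := by
      rw [← toDual_gradient, InnerProductSpace.toDual_apply_apply]
    rw [h3] at h2
    have h4 : HasDerivAt (fun t : ℝ => t * inner ℝ (gradient F y₀) h)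
        (inner ℝ (gradient F y₀) h) t := by
      simpa using (hasDerivAt_id t).mul_const (inner ℝ (gradient F y₀) h)
    have h5 : HasDerivAt (fun t : ℝ => μ / 4 * t ^ 2 * ‖h‖ ^ 2) (μ / 2 * t * ‖h‖ ^ 2) t := by
      convert! (((hasDerivAt_id t).pow 2).const_mul (μ / 4)).mul_const (‖h‖ ^ 2) using 1
      simp only [id_eq, Nat.cast_ofNat, mul_one]; ring
    exact (h2.sub h4).sub h5
  have hmono : MonotoneOn ψ (Set.Icc 0 1) := by
    refine monotoneOn_of_deriv_nonneg (convex_Icc 0 1)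
      (fun t ht => (hderiv t ht).continuousAt.continuousWithinAt)
      (fun t ht => (hderiv t (interior_subset ht)).differentiableAt.differentiableWithinAt) ?_
    intro t ht
    have ht' := interior_subset ht
    rw [(hderiv t ht').deriv]
    have h1 := (hball _ (hmem t ht')).1
    rw [add_sub_cancel_left, norm_smul, Real.norm_of_nonneg ht'.1, map_smul] at h1
    set e := gradient F (y₀ + t • h) - gradient F y₀ - t • fderiv ℝ (gradient F) y₀ h with he
    have h2 : (inner ℝ (gradient F (y₀ + t • h)) h : ℝ) - inner ℝ (gradient F y₀) h
        = inner ℝ e h + t * inner ℝ (fderiv ℝ (gradient F) y₀ h) h := by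
      rw [he, inner_sub_left, inner_sub_left, real_inner_smul_left]; ring
    have h3 := neg_le_of_abs_le (abs_real_inner_le_norm e h)
    rw [h2]
    nlinarith [mul_le_mul_of_nonneg_left (hμH h) ht'.1,
      mul_le_mul_of_nonneg_right h1 (norm_nonneg h)]
  have := hmono (Set.left_mem_Icc.2 zero_le_one) (Set.right_mem_Icc.2 zero_le_one) zero_le_one
  simp only [hψ, zero_smul, add_zero, one_smul, hh, add_sub_cancel] at this ⊢
  linarith

end Growth

/-- The line through `x` and `v` stays in the affine hull, relative to which `x` is an interior
point. -/
theorem exists_add_smul_sub_mem {V : Type*} [AddCommGroup V] [Module ℝ V] [TopologicalSpace V]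
    [IsTopologicalAddGroup V] [ContinuousSMul ℝ V] {s : Set V} {x v : V}
    (hx : x ∈ intrinsicInterior ℝ s) (hv : v ∈ s) : ∃ ε : ℝ, 0 < ε ∧ x + ε • (x - v) ∈ s := by
  obtain ⟨y, hy, rfl⟩ := mem_intrinsicInterior.1 hx
  have hmem : ∀ t : ℝ, (y : V) + t • ((y : V) - v) ∈ affineSpan ℝ s := by
    intro t
    have := AffineMap.lineMap_mem (-t) y.2 (subset_affineSpan ℝ s hv)
    rw [AffineMap.lineMap_apply] at this
    convert! this using 1
    simp only [vsub_eq_sub, vadd_eq_add, neg_smul, ← smul_neg, neg_sub, add_comm]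
  have hcont : Continuous fun t : ℝ => (⟨(y : V) + t • ((y : V) - v), hmem t⟩ : affineSpan ℝ s) :=
    Continuous.subtype_mk (by fun_prop) _
  have h0 : (⟨(y : V) + (0 : ℝ) • ((y : V) - v), hmem 0⟩ : affineSpan ℝ s) = y := by
    ext; simp
  have hev : ∀ᶠ t in 𝓝 (0 : ℝ), (y : V) + t • ((y : V) - v) ∈ s := by
    have h1 := hcont.continuousAt (x := (0 : ℝ))
    have h2 : Subtype.val ⁻¹' s ∈ 𝓝 (⟨(y : V) + (0 : ℝ) • ((y : V) - v), hmem 0⟩ :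
        affineSpan ℝ s) := by
      rw [h0]; exact mem_interior_iff_mem_nhds.1 hy
    exact h1 h2
  obtain ⟨ε, h1, h2⟩ := ((hev.filter_mono nhdsWithin_le_nhds).and
    (self_mem_nhdsWithin (s := Set.Ioi (0 : ℝ)))).exists
  exact ⟨ε, h2, h1⟩

/-! ### Transfer to matrices and passage to the limit -/

section Bridge

variable {n₁ n₂ m : ℕ}

theorem frobInner_eq_sum (A B : Matrix (Fin n₁) (Fin n₂) ℝ) :
    frobInner A B = ∑ j, ∑ i, A i j * B i j := by
  simp [frobInner, Matrix.trace, Matrix.mul_apply]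

theorem frobInner_eq_hsInner (A B : Matrix (Fin n₁) (Fin n₂) ℝ) :
    frobInner A B = hsInner (toEuclideanLin A) (toEuclideanLin B) := by
  rw [hsInner_eq_sum (EuclideanSpace.basisFun (Fin n₂) ℝ), frobInner_eq_sum]
  refine Finset.sum_congr rfl fun j _ => ?_
  simp [PiLp.inner_apply, Matrix.toLpLin_apply, mul_comm]

theorem nuclearNorm_eq_opNuclear (A : Matrix (Fin n₁) (Fin n₂) ℝ) :
    nuclearNorm A = opNuclear (toEuclideanLin A) := by
  simp [nuclearNorm, opNuclear]

theorem mem_subdifferential_nuclearNorm_iff {V X : Matrix (Fin n₁) (Fin n₂) ℝ} :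
    V ∈ subdifferential nuclearNorm X ↔
      (∀ x, ‖toEuclideanLin V x‖ ≤ ‖x‖) ∧ frobInner V X = nuclearNorm X := by
  simp only [subdifferential, Set.mem_ofPred_eq, frobInner_eq_hsInner, nuclearNorm_eq_opNuclear,
    map_sub]
  constructor
  · intro h
    refine contraction_of_forall_hsInner_le fun Z => ?_
    simpa using h (toEuclideanLin.symm Z)
  · rintro ⟨h1, h2⟩ Z
    exact forall_hsInner_le_of_contraction h1 h2 _

theorem frobInner_add_right (A B C : Matrix (Fin n₁) (Fin n₂) ℝ) :
    frobInner A (B + C) = frobInner A B + frobInner A C := by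
  simp [frobInner, Matrix.mul_add]

theorem frobInner_smul_right (c : ℝ) (A B : Matrix (Fin n₁) (Fin n₂) ℝ) :
    frobInner A (c • B) = c * frobInner A B := by
  simp [frobInner]

theorem frobInner_neg_left (A B : Matrix (Fin n₁) (Fin n₂) ℝ) :
    frobInner (-A) B = -frobInner A B := by
  simp [frobInner]

theorem frobNorm_nonneg (A : Matrix (Fin n₁) (Fin n₂) ℝ) : 0 ≤ frobNorm A := Real.sqrt_nonneg _

theorem frobNorm_smul (c : ℝ) (A : Matrix (Fin n₁) (Fin n₂) ℝ) :
    frobNorm (c • A) = |c| * frobNorm A := by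
  rw [frobNorm, frobNorm, ← Real.sqrt_sq_eq_abs, ← Real.sqrt_mul (sq_nonneg c)]
  simp [frobInner, sq, mul_assoc]

theorem abs_apply_le_frobNorm (A : Matrix (Fin n₁) (Fin n₂) ℝ) (i : Fin n₁) (j : Fin n₂) :
    |A i j| ≤ frobNorm A := by
  refine Real.abs_le_sqrt ?_
  rw [frobInner_eq_sum, sq]
  refine le_trans ?_ (Finset.single_le_sum (f := fun j => ∑ i, A i j * A i j)
    (fun j _ => Finset.sum_nonneg fun i _ => mul_self_nonneg _) (Finset.mem_univ j))
  exact Finset.single_le_sum (f := fun i => A i j * A i j)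
    (fun i _ => mul_self_nonneg _) (Finset.mem_univ i)

theorem frobNorm_pos {A : Matrix (Fin n₁) (Fin n₂) ℝ} (hA : A ≠ 0) : 0 < frobNorm A := by
  refine (frobNorm_nonneg A).lt_of_ne fun h => hA ?_
  ext i j
  have := abs_apply_le_frobNorm A i j
  rw [← h] at this
  simpa using this

theorem continuous_frobInner_right (A : Matrix (Fin n₁) (Fin n₂) ℝ) :
    Continuous fun B => frobInner A B :=
  (continuous_const.matrix_mul continuous_id).matrix_trace

theorem continuous_frobNorm : Continuous fun A : Matrix (Fin n₁) (Fin n₂) ℝ => frobNorm A :=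
  Real.continuous_sqrt.comp (continuous_id.matrix_transpose.matrix_mul continuous_id).matrix_trace

/-- The entries lie in `[-1, 1]`, so a cube gives compactness; continuity of the Frobenius norm
keeps the limit nonzero. -/
theorem exists_subseq_tendsto_of_frobNorm_eq_one {W : ℕ → Matrix (Fin n₁) (Fin n₂) ℝ}
    (hW : ∀ k, frobNorm (W k) = 1) : ∃ (W₀ : Matrix (Fin n₁) (Fin n₂) ℝ) (φ : ℕ → ℕ),
      StrictMono φ ∧ Tendsto (W ∘ φ) atTop (𝓝 W₀) ∧ W₀ ≠ 0 := by
  have hc : IsCompact (Set.pi Set.univ fun _ : Fin n₁ => Set.pi Set.univ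
      fun _ : Fin n₂ => Set.Icc (-1 : ℝ) 1) :=
    isCompact_univ_pi fun _ => isCompact_univ_pi fun _ => isCompact_Icc
  obtain ⟨W₀, -, φ, hφ, h⟩ := hc.tendsto_subseq (x := fun k i j => W k i j) fun k i _ j _ =>
    abs_le.1 (hW k ▸ abs_apply_le_frobNorm (W k) i j)
  refine ⟨W₀, φ, hφ, h, ?_⟩
  rintro rfl
  have h1 : Tendsto (fun k => frobNorm (W (φ k))) atTop (𝓝 (frobNorm 0)) :=
    (continuous_frobNorm.tendsto 0).comp h
  simp only [hW] at h1
  have := tendsto_nhds_unique h1 tendsto_const_nhds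
  simp [frobNorm, frobInner] at this

/-- If `nuclearNorm - ⟪Y, ·⟫` vanishes to second order along a sequence approaching `X` in the
direction `W`, then it vanishes on a segment from `X` in the direction `W`. -/
theorem exists_nuclearNorm_add_smul_le {X Y W : Matrix (Fin n₁) (Fin n₂) ℝ}
    (hY : Y ∈ intrinsicInterior ℝ (subdifferential nuclearNorm X))
    {t δ : ℕ → ℝ} {Wk : ℕ → Matrix (Fin n₁) (Fin n₂) ℝ} (ht : ∀ k, 0 < t k)
    (ht0 : Tendsto t atTop (𝓝 0)) (hδ : Tendsto δ atTop (𝓝 0)) (hW : Tendsto Wk atTop (𝓝 W))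
    (hgap : ∀ k, nuclearNorm (X + t k • Wk k) - frobInner Y (X + t k • Wk k) ≤ δ k * t k ^ 2) :
    ∃ s : ℝ, 0 < s ∧ nuclearNorm (X + s • W) ≤ frobInner Y (X + s • W) := by
  have hYs := mem_subdifferential_nuclearNorm_iff.1 (intrinsicInterior_subset hY)
  obtain ⟨hY1, hYX⟩ := hYs
  have hlim : ∀ A : Matrix (Fin n₁) (Fin n₂) ℝ,
      Tendsto (fun k => frobInner A (Wk k)) atTop (𝓝 (frobInner A W)) := fun A =>
    ((continuous_frobInner_right A).tendsto W).comp hW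
  have hext : ∀ V ∈ subdifferential nuclearNorm X,
      ∃ ε : ℝ, 0 < ε ∧ Y + ε • (Y - V) ∈ subdifferential nuclearNorm X := fun V hV =>
    exists_add_smul_sub_mem hY hV
  -- The subgradient inequality at `X + t k • Wk k` and the gap bound, divided by `t k`, leave an
  -- error `δ k * t k`.
  have hVle : ∀ V ∈ subdifferential nuclearNorm X, frobInner V W ≤ frobInner Y W := by
    intro V hV
    have h1 : ∀ k, frobInner V (Wk k) ≤ frobInner Y (Wk k) + δ k * t k := by
      intro k
      have h2 := hV (X + t k • Wk k)
      have h3 := hgap k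
      rw [add_sub_cancel_left, frobInner_smul_right] at h2
      rw [frobInner_add_right, frobInner_smul_right, hYX] at h3
      refine le_of_mul_le_mul_left ?_ (ht k)
      nlinarith
    have h2 := (hlim Y).add (hδ.mul ht0)
    rw [mul_zero, add_zero] at h2
    exact le_of_tendsto_of_tendsto' (hlim V) h2 h1
  -- The reverse inequality comes from the subgradient on the other side of `Y`, namely `Y + ε • (Y
  -- - V)`.
  have hVeq : ∀ V ∈ subdifferential nuclearNorm X, frobInner V W = frobInner Y W := by
    intro V hV
    refine (hVle V hV).antisymm ?_
    obtain ⟨ε, hε, h⟩ := hext V hV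
    have h1 := hVle _ h
    simp only [frobInner_eq_hsInner, map_add, map_smul, map_sub, hsInner_add_left,
      hsInner_smul_left, hsInner_sub_left] at h1 ⊢
    nlinarith
  have hrot : ∀ (B : Matrix (Fin n₁) (Fin n₂) ℝ) (C : ℝ), 0 ≤ C →
      (∀ (τ : ℝ) Z, frobInner Y Z + τ * frobInner B Z ≤ (1 + C * τ ^ 2) * nuclearNorm Z) →
      frobInner B W = 0 := by
    intro B C hC hB
    have hBX : frobInner B X = 0 :=
      eq_zero_of_forall_add_mul_le (p := nuclearNorm X) (C := C) fun τ => hYX ▸ hB τ X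
    -- Rotating by `τ = σ * t k` balances the orders: after division by `t k ^ 2`, the limit is `σ
    -- ⟨B, W⟩ ≤ C σ² ‖X‖_*` for every `σ`.
    refine eq_zero_of_forall_add_mul_le (p := nuclearNorm X) (C := C) fun σ => ?_
    have h1 : ∀ k, σ * frobInner B (Wk k) ≤ δ k + C * σ ^ 2 *
        (nuclearNorm X + t k * frobInner Y (Wk k) + δ k * t k ^ 2) := by
      intro k
      have h2 := hB (σ * t k) (X + t k • Wk k)
      have h3 := hgap k
      simp only [frobInner_add_right, frobInner_smul_right, hYX, hBX] at h2 h3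
      have h4 : C * σ ^ 2 * nuclearNorm (X + t k • Wk k) ≤ C * σ ^ 2 *
        (nuclearNorm X + t k * frobInner Y (Wk k) + δ k * t k ^ 2) :=
        mul_le_mul_of_nonneg_left (by linarith) (by positivity)
      refine le_of_mul_le_mul_left ?_ (pow_pos (ht k) 2)
      nlinarith [mul_le_mul_of_nonneg_left h4 (sq_nonneg (t k))]
    have h2 := hδ.add (((tendsto_const_nhds (x := nuclearNorm X)).add (ht0.mul (hlim Y))
      |>.add (hδ.mul (ht0.pow 2))).const_mul (C * σ ^ 2))
    have h3 := le_of_tendsto_of_tendsto' ((hlim B).const_mul σ) h2 h1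
    simp only [zero_mul, add_zero, zero_add] at h3
    linarith
  have hskew : ∀ B : EuclideanSpace ℝ (Fin n₂) →ₗ[ℝ] EuclideanSpace ℝ (Fin n₁),
      (∃ C : ℝ, 0 ≤ C ∧ ∀ (τ : ℝ) Z, hsInner (toEuclideanLin Y) Z + τ * hsInner B Z ≤
        (1 + C * τ ^ 2) * opNuclear Z) → hsInner B (toEuclideanLin W) = 0 := by
    rintro B ⟨C, hC, h⟩
    have := hrot (toEuclideanLin.symm B) C hC fun τ Z => by
      simpa [frobInner_eq_hsInner, nuclearNorm_eq_opNuclear] using h τ (toEuclideanLin Z)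
    simpa [frobInner_eq_hsInner] using this
  have hmem : ∀ V : EuclideanSpace ℝ (Fin n₂) →ₗ[ℝ] EuclideanSpace ℝ (Fin n₁),
      (∀ x, ‖V x‖ ≤ ‖x‖) → hsInner V (toEuclideanLin X) = opNuclear (toEuclideanLin X) →
      toEuclideanLin.symm V ∈ subdifferential nuclearNorm X := fun V h1 h2 =>
    mem_subdifferential_nuclearNorm_iff.2 ⟨by simpa using h1, by
      simpa [frobInner_eq_hsInner, nuclearNorm_eq_opNuclear] using h2⟩
  obtain ⟨s, hs, h⟩ := exists_opNuclear_add_smul_le (T := toEuclideanLin X)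
    (Y := toEuclideanLin Y) (W := toEuclideanLin W) hY1
    (by rw [← frobInner_eq_hsInner, hYX, nuclearNorm_eq_opNuclear])
    (fun V h1 h2 => by
      obtain ⟨ε, hε, h⟩ := hext _ (hmem V h1 h2)
      refine ⟨ε, hε, ?_⟩
      simpa using (mem_subdifferential_nuclearNorm_iff.1 h).1)
    (fun V h1 h2 => by simpa [frobInner_eq_hsInner] using hVeq _ (hmem V h1 h2))
    (fun a b => by
      rw [← sub_eq_zero, ← hsInner_skew_left]
      exact hskew _ (exists_hsInner_skew_left_le hY1 (inner_outer_sub_outer a b)))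
    (fun a b => by
      rw [← sub_eq_zero, ← hsInner_skew_right]
      exact hskew _ (exists_hsInner_skew_right_le hY1 (inner_outer_sub_outer a b)))
  refine ⟨s, hs, ?_⟩
  simpa [frobInner_eq_hsInner, nuclearNorm_eq_opNuclear] using h

end Bridge

end NuclearMin

end

noncomputable section

namespace NuclearMin

open Filter Topology

/-! ### The two implications for the objective -/

section Objective

variable {n₁ n₂ m : ℕ} {Φ : Matrix (Fin n₁) (Fin n₂) ℝ →ₗ[ℝ] EuclideanSpace ℝ (Fin m)}
  {f : EuclideanSpace ℝ (Fin m) → EReal} {X : Matrix (Fin n₁) (Fin n₂) ℝ}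

theorem nuclearNorm_add_le (A B : Matrix (Fin n₁) (Fin n₂) ℝ) :
    nuclearNorm (A + B) ≤ nuclearNorm A + nuclearNorm B := by
  simpa [nuclearNorm_eq_opNuclear] using
    opNuclear_add_le (toEuclideanLin A) (toEuclideanLin B)

theorem nuclearNorm_smul_le {c : ℝ} (hc : 0 ≤ c) (A : Matrix (Fin n₁) (Fin n₂) ℝ) :
    nuclearNorm (c • A) ≤ c * nuclearNorm A := by
  simpa [nuclearNorm_eq_opNuclear] using opNuclear_smul_le hc (toEuclideanLin A)

theorem IsLoss.coe_finitePart (hf : IsLoss f) {y : EuclideanSpace ℝ (Fin m)}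
    (hy : y ∈ effDom f) : ((finitePart f y : ℝ) : EReal) = f y :=
  EReal.coe_toReal (ne_of_lt hy) (hf.ne_bot y)

theorem IsLoss.objective_eq (hf : IsLoss f) (h : Φ X ∈ effDom f) :
    objective f Φ X = ((finitePart f (Φ X) + nuclearNorm X : ℝ) : EReal) := by
  rw [objective, ← hf.coe_finitePart h, EReal.coe_add]

theorem mem_effDom_of_objective_lt_top (h : objective f Φ X < ⊤) : Φ X ∈ effDom f := by
  refine (lt_top_iff_ne_top (a := f (Φ X))).2 fun h1 => ?_
  rw [objective, h1, EReal.top_add_coe] at h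
  exact lt_irrefl _ h

theorem exists_norm_map_le_mul_frobNorm
    (Φ : Matrix (Fin n₁) (Fin n₂) ℝ →ₗ[ℝ] EuclideanSpace ℝ (Fin m)) :
    ∃ K : ℝ, 0 ≤ K ∧ ∀ W, ‖Φ W‖ ≤ K * frobNorm W := by
  refine ⟨∑ i, ∑ j, ‖Φ (Matrix.single i j 1)‖, by positivity, fun W => ?_⟩
  conv_lhs => rw [Matrix.matrix_eq_sum_single W]
  simp only [map_sum, Finset.sum_mul]
  refine (norm_sum_le _ _).trans (Finset.sum_le_sum fun i _ =>
    (norm_sum_le _ _).trans (Finset.sum_le_sum fun j _ => ?_))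
  have h : Φ (Matrix.single i j (W i j)) = W i j • Φ (Matrix.single i j 1) := by
    rw [← map_smul, Matrix.smul_single, smul_eq_mul, mul_one]
  rw [h, norm_smul, mul_comm]
  gcongr
  exact abs_apply_le_frobNorm W i j

theorem IsStrongSolution.isUniqueSolution (hf : IsLoss f) (hX : Φ X ∈ effDom f)
    (h : IsStrongSolution (objective f Φ) X) : IsUniqueSolution (objective f Φ) X := by
  obtain ⟨ε, hε, κ, hκ, h⟩ := h
  intro Z hZX
  by_contra! hle
  have hφX := hf.objective_eq hX
  have hZ : Φ Z ∈ effDom f := mem_effDom_of_objective_lt_top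
    (hle.trans_lt (hφX ▸ EReal.coe_lt_top _))
  rw [hφX, hf.objective_eq hZ, EReal.coe_le_coe_iff] at hle
  have hn : 0 < frobNorm (Z - X) := frobNorm_pos (sub_ne_zero.2 hZX)
  set n := frobNorm (Z - X) with hn_def
  -- A convex combination of `X` and `Z` close enough to `X` for the growth bound to apply.
  obtain ⟨t, ht0, ht1, htε⟩ : ∃ t : ℝ, 0 < t ∧ t ≤ 1 ∧ t * n < ε := by
    refine ⟨min 1 (ε / (2 * n)), by positivity, min_le_left _ _, ?_⟩
    refine (mul_le_mul_of_nonneg_right (min_le_right _ _) hn.le).trans_lt ?_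
    rw [div_mul_eq_mul_div, div_lt_iff₀ (by positivity)]
    nlinarith
  have hcomb : X + t • (Z - X) = (1 - t) • X + t • Z := by module
  have hs := h (X + t • (Z - X)) (by
    rw [add_sub_cancel_left, frobNorm_smul, abs_of_pos ht0]; exact htε)
  rw [add_sub_cancel_left, frobNorm_smul, abs_of_pos ht0, ← hn_def] at hs
  have hconv := hf.convex (x := (Φ X, finitePart f (Φ X))) (y := (Φ Z, finitePart f (Φ Z)))
    (hf.coe_finitePart hX).ge (hf.coe_finitePart hZ).ge (sub_nonneg.2 ht1) ht0.le (by ring)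
  have hf' : f (Φ (X + t • (Z - X))) ≤
      (((1 - t) * finitePart f (Φ X) + t * finitePart f (Φ Z) : ℝ) : EReal) := by
    rw [hcomb, map_add, map_smul, map_smul]
    exact hconv
  have hnuc : nuclearNorm (X + t • (Z - X)) ≤ (1 - t) * nuclearNorm X + t * nuclearNorm Z := by
    rw [hcomb]
    exact (nuclearNorm_add_le _ _).trans (add_le_add (nuclearNorm_smul_le (sub_nonneg.2 ht1) _)
      (nuclearNorm_smul_le ht0.le _))
  have hφ : objective f Φ (X + t • (Z - X)) ≤
      (((1 - t) * finitePart f (Φ X) + t * finitePart f (Φ Z) +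
        ((1 - t) * nuclearNorm X + t * nuclearNorm Z) : ℝ) : EReal) := by
    rw [objective, EReal.coe_add]
    exact add_le_add hf' (EReal.coe_le_coe_iff.2 hnuc)
  have hfin := hs.trans (EReal.sub_le_sub hφ (le_of_eq hφX.symm))
  rw [← EReal.coe_sub, EReal.coe_le_coe_iff] at hfin
  have : 0 < κ / 2 * (t * n) ^ 2 := by positivity
  nlinarith

theorem IsUniqueSolution.isStrongSolution (hf : IsLoss f) (hX : Φ X ∈ interior (effDom f))
    (hnd : -adjointMap Φ (gradient (finitePart f) (Φ X)) ∈
      intrinsicInterior ℝ (subdifferential nuclearNorm X))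
    (h : IsUniqueSolution (objective f Φ) X) : IsStrongSolution (objective f Φ) X := by
  set Y := -adjointMap Φ (gradient (finitePart f) (Φ X)) with hYdef
  have hYinner : ∀ Z, frobInner Y Z = -inner ℝ (gradient (finitePart f) (Φ X)) (Φ Z) := fun Z => by
    rw [hYdef, frobInner_neg_left, frobInner_adjointMap]
  have hYsub := intrinsicInterior_subset hnd
  have hYX := (mem_subdifferential_nuclearNorm_iff.1 hYsub).2
  have hX' := interior_subset hX
  obtain ⟨c, hc, hgrow⟩ := exists_quadratic_growth
    (hf.contDiffOn.contDiffAt (isOpen_interior.mem_nhds hX)) (hf.hessian_posDef _ hX)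
  obtain ⟨r, hr, hball⟩ := Metric.eventually_nhds_iff_ball.1
    (hgrow.and (isOpen_interior.mem_nhds hX))
  obtain ⟨K, hK, hΦK⟩ := exists_norm_map_le_mul_frobNorm Φ
  by_contra hns
  -- Growth with constant `1 / (k + 1)` fails for each `k`; the radius `r / (K + 1)` keeps `Φ (Z k)`
  -- where `f` grows quadratically.
  have hbad : ∀ k : ℕ, ∃ Z : Matrix (Fin n₁) (Fin n₂) ℝ,
      frobNorm (Z - X) < min (1 / ((k : ℝ) + 1)) (r / (K + 1)) ∧
      ¬ (((1 / ((k : ℝ) + 1) / 2 * frobNorm (Z - X) ^ 2 : ℝ) : EReal) ≤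
        objective f Φ Z - objective f Φ X) := by
    intro k
    by_contra! hk
    exact hns ⟨_, by positivity, _, by positivity, hk⟩
  choose Z hZ hZbad using hbad
  set t : ℕ → ℝ := fun k => frobNorm (Z k - X) with ht
  set δ : ℕ → ℝ := fun k => 1 / ((k : ℝ) + 1) / 2 with hδ
  have hδ0 : Tendsto δ atTop (𝓝 0) := by
    simpa [hδ] using (tendsto_one_div_add_atTop_nhds_zero_nat (𝕜 := ℝ)).div_const 2
  have ht0 : Tendsto t atTop (𝓝 0) :=
    squeeze_zero (fun k => frobNorm_nonneg _) (fun k => (hZ k).le.trans (min_le_left _ _))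
      tendsto_one_div_add_atTop_nhds_zero_nat
  have htpos : ∀ k, 0 < t k := by
    intro k
    refine frobNorm_pos fun h0 => hZbad k ?_
    rw [sub_eq_zero.1 h0, hf.objective_eq hX', ← EReal.coe_sub]
    simp [frobNorm, frobInner]
  set W : ℕ → Matrix (Fin n₁) (Fin n₂) ℝ := fun k => (t k)⁻¹ • (Z k - X) with hW
  have hWn : ∀ k, frobNorm (W k) = 1 := fun k => by
    rw [hW, frobNorm_smul, abs_of_pos (inv_pos.2 (htpos k))]
    exact inv_mul_cancel₀ (htpos k).ne'
  have hZW : ∀ k, Z k = X + t k • W k := fun k => by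
    rw [hW, smul_inv_smul₀ (htpos k).ne', add_sub_cancel]
  -- The gradient term of `f` is `-⟨Y, ·⟩`, so it turns the nuclear norm increment into the gap.
  -- Both terms on the left are nonnegative, hence each is `o(t k ^ 2)`.
  have hmain : ∀ k, c * t k ^ 2 * ‖Φ (W k)‖ ^ 2 +
      (nuclearNorm (X + t k • W k) - frobInner Y (X + t k • W k)) ≤ δ k * t k ^ 2 := by
    intro k
    have hmem : Φ (Z k) ∈ Metric.ball (Φ X) r := by
      rw [mem_ball_iff_norm, ← map_sub]
      refine (hΦK _).trans_lt ?_
      have := (hZ k).trans_le (min_le_right _ _)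
      rw [lt_div_iff₀ (by positivity)] at this
      nlinarith [frobNorm_nonneg (Z k - X)]
    obtain ⟨h1, h2⟩ := hball _ hmem
    have h3 := hZbad k
    rw [hf.objective_eq hX', hf.objective_eq (interior_subset h2), ← EReal.coe_sub,
      EReal.coe_le_coe_iff, not_le] at h3
    have h4 : Φ (Z k) - Φ X = t k • Φ (W k) := by
      rw [hZW k, map_add, map_smul, add_sub_cancel_left]
    rw [h4, norm_smul, Real.norm_of_nonneg (htpos k).le, mul_pow, real_inner_smul_right] at h1
    have h5 := hYinner (W k)
    rw [← hZW k]
    have h6 : frobInner Y (Z k) = nuclearNorm X + t k * frobInner Y (W k) := by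
      rw [hZW k, frobInner_add_right, frobInner_smul_right, hYX]
    rw [h6, h5]
    simp only [hδ, ht] at h3 ⊢
    linarith
  have hgapnn : ∀ Z, 0 ≤ nuclearNorm Z - frobInner Y Z := by
    intro Z
    have := hYsub (X + (Z - X))
    have h1 := frobInner_add_right Y X (Z - X)
    rw [add_sub_cancel_left] at this
    rw [add_sub_cancel] at this h1
    linarith
  obtain ⟨W₀, φ, hφ, hlim, hW₀⟩ := exists_subseq_tendsto_of_frobNorm_eq_one hWn
  have hφt := hφ.tendsto_atTop
  obtain ⟨s, hs, hsW⟩ := exists_nuclearNorm_add_smul_le hnd (fun k => htpos (φ k))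
    (ht0.comp hφt) (hδ0.comp hφt) hlim fun k => by
      have := hmain (φ k)
      have h1 : 0 ≤ c * t (φ k) ^ 2 * ‖Φ (W (φ k))‖ ^ 2 := by positivity
      exact (le_add_of_nonneg_left h1).trans this
  have hΦW : Φ W₀ = 0 := by
    have hcont : Continuous Φ := LinearMap.continuous_of_finiteDimensional Φ
    have h1 : Tendsto (fun k => c * ‖Φ (W (φ k))‖ ^ 2) atTop (𝓝 (c * ‖Φ W₀‖ ^ 2)) :=
      ((((hcont.tendsto W₀).comp hlim).norm).pow 2).const_mul c
    have h2 := le_of_tendsto_of_tendsto' h1 (hδ0.comp hφt) fun k => by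
      have h3 := hmain (φ k)
      have h4 := hgapnn (X + t (φ k) • W (φ k))
      refine le_of_mul_le_mul_right ?_ (pow_pos (htpos (φ k)) 2)
      simp only [Function.comp_apply]
      linarith
    have h3 : ‖Φ W₀‖ ^ 2 = 0 := le_antisymm (by nlinarith) (sq_nonneg _)
    exact norm_eq_zero.1 (pow_eq_zero_iff two_ne_zero |>.1 h3)
  -- The competitor: it has the same image under `Φ` and a nuclear norm no larger than that of `X`.
  have hne : X + s • W₀ ≠ X := fun h0 =>
    hW₀ ((smul_eq_zero.1 (add_eq_left.1 h0)).resolve_left hs.ne')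
  have hΦ : Φ (X + s • W₀) = Φ X := by rw [map_add, map_smul, hΦW, smul_zero, add_zero]
  have huniq := h _ hne
  rw [hf.objective_eq hX', hf.objective_eq (hΦ ▸ hX'), EReal.coe_lt_coe_iff, hΦ] at huniq
  rw [frobInner_add_right, frobInner_smul_right, hYX, hYinner W₀, hΦW, inner_zero_right] at hsW
  linarith

end Objective

end NuclearMin

end

theorem corollary3p9 {n₁ n₂ m : ℕ}
    (Φ : Matrix (Fin n₁) (Fin n₂) ℝ →ₗ[ℝ] EuclideanSpace ℝ (Fin m))
    (f : EuclideanSpace ℝ (Fin m) → EReal) (hf : NuclearMin.IsLoss f)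
    (X : Matrix (Fin n₁) (Fin n₂) ℝ)
    (hdom : Φ X ∈ interior (NuclearMin.effDom f))
    (hopt : NuclearMin.IsOptimalSolution (NuclearMin.objective f Φ) X)
    (hnd : -NuclearMin.adjointMap Φ (gradient (NuclearMin.finitePart f) (Φ X)) ∈
      intrinsicInterior ℝ (NuclearMin.subdifferential NuclearMin.nuclearNorm X)) :
    NuclearMin.IsUniqueSolution (NuclearMin.objective f Φ) X ↔
      NuclearMin.IsStrongSolution (NuclearMin.objective f Φ) X :=
  ⟨fun h => h.isStrongSolution hf hdom hnd,
    fun h => h.isUniqueSolution hf (interior_subset hdom)⟩
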